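/- Let $K$ be a field of characteristic zero and let $E$ be a finite-dimensional $K$-vector space equipped with a non-degenerate symmetric $K$-bilinear form $\langle\,,\,\rangle_E : E\times E\to K$. Let $\mathrm{O}(E)$ be the group of all $K$-linear automorphisms of $E$ which preserve $\langle\,,\,\rangle_E$, and let $\mathrm{SO}(E)=\{g\in \mathrm{O}(E)\mid \det g=1\}$. Put $$\mathrm{S}\breve{\mathrm{O}}(E):=\left\{(g,\delta)\in \mathrm{O}(E)\times\{\pm1\}\ \middle|\ \det g=\delta^{\left\lfloor \frac{\dim E+1}{2}\right\rfloor}\right\},$$ a subgroup of the direct product $\mathrm{O}(E)\times\{\pm1\}$ (if $E=0$, then $\det g=1$ for the only element $g$ of $\mathrm{O}(E)$, and $\mathrm{S}\breve{\mathrm{O}}(E)=\mathrm{O}(E)\times\{\pm1\}$), and regard $\mathrm{SO}(E)$ as a subgroup of $\mathrm{S}\breve{\mathrm{O}}(E)$ via $x\mapsto (x,1)$. Then for every $x\in \mathrm{SO}(E)$ there is an element $\breve g\in \mathrm{S}\breve{\mathrm{O}}(E)\setminus \mathrm{SO}(E)$ such that $\breve g\,x\,\breve g^{-1}=x^{-1}$.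 -/

import Mathlib

namespace MVW

section

variable {K E : Type*} [Field K] [AddCommGroup E] [Module K E]

/-- The orthogonal group `O(E)` of a vector space `E` with bilinear form `B`: the group of all
linear automorphisms of `E` that preserve `B`. -/
def orthogonalGroup (B : LinearMap.BilinForm K E) : Subgroup (E ≃ₗ[K] E) where
  carrier := {g | ∀ u v : E, B (g u) (g v) = B u v}
  mul_mem' {a b} ha hb u v := (ha (b u) (b v)).trans (hb u v)
  one_mem' _ _ := rfl
  inv_mem' {a} ha u v := by
    have h := ha (a.symm u) (a.symm v)
    rw [LinearEquiv.apply_symm_apply, LinearEquiv.apply_symm_apply] at h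
    exact h.symm

/-- The determinant, as a homomorphism from `O(E)` to the unit group of `K`. -/
noncomputable def orthogonalDet (B : LinearMap.BilinForm K E) : orthogonalGroup B →* Kˣ :=
  LinearEquiv.det.comp (orthogonalGroup B).subtype

/-- The special orthogonal group `SO(E)`: the elements of `O(E)` of determinant one. -/
noncomputable def specialOrthogonalGroup (B : LinearMap.BilinForm K E) :
    Subgroup (orthogonalGroup B) where
  carrier := {g | orthogonalDet B g = 1}
  mul_mem' {a b} ha hb := by
    simp only [Set.mem_ofPred_eq] at ha hb ⊢
    rw [map_mul, ha, hb, one_mul]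
  one_mem' := map_one _
  inv_mem' {a} ha := by
    simp only [Set.mem_ofPred_eq] at ha ⊢
    rw [map_inv, ha, inv_one]

/-- The sign group `{±1}` (realised as `ℤˣ`) mapped into the unit group of `K`. -/
def signHom (K : Type*) [Field K] : ℤˣ →* Kˣ :=
  Units.map (Int.castRingHom K : ℤ →* K)

/-- The extended special orthogonal group: the subgroup of `O(E) × {±1}` of all pairs `(g, δ)` with
`det g = δ ^ ⌊(dim E + 1) / 2⌋` (the division is the rounding-down division of natural numbers). -/
noncomputable def extendedSpecialOrthogonalGroup (B : LinearMap.BilinForm K E) :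
    Subgroup (orthogonalGroup B × ℤˣ) where
  carrier := {p | orthogonalDet B p.1 = signHom K p.2 ^ ((Module.finrank K E + 1) / 2)}
  mul_mem' {a b} ha hb := by
    simp only [Set.mem_ofPred_eq] at ha hb ⊢
    rw [Prod.fst_mul, Prod.snd_mul, map_mul, map_mul, mul_pow, ha, hb]
  one_mem' := by simp
  inv_mem' {a} ha := by
    simp only [Set.mem_ofPred_eq] at ha ⊢
    rw [Prod.fst_inv, Prod.snd_inv, map_inv, map_inv, inv_pow, ha]

/-- The inclusion of `SO(E)` into its extension, `x ↦ (x, 1)`. -/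
noncomputable def specialOrthogonalInclusion (B : LinearMap.BilinForm K E) :
    specialOrthogonalGroup B →* extendedSpecialOrthogonalGroup B where
  toFun x := ⟨((x : orthogonalGroup B), 1), by
    have hx : orthogonalDet B (x : orthogonalGroup B) = 1 := x.2
    change orthogonalDet B (x : orthogonalGroup B) =
      signHom K 1 ^ ((Module.finrank K E + 1) / 2)
    rw [hx, map_one, one_pow]⟩
  map_one' := rfl
  map_mul' x y := by
    apply Subtype.ext
    apply Prod.ext
    · rfl
    · exact (one_mul (1 : ℤˣ)).symm

end

end MVW

/-! Laurent polynomials act on `E` with `T` acting as `x`; the adjoint of `a` is `a*`, its image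
under `T ↦ T⁻¹`. If `E` is generated by one vector `v`, the map `a v ↦ a* v` inverts `x` and is an
isometry, because `B (a* v) (b* v) = B (b v) (a v)`. The work lies in reaching such generators and
in controlling the determinant.

The normalisation `det g = (-1) ^ ⌊dim E / 2⌋` survives orthogonal sums, up to a sign change on one
summand (`HasInverter.of_isCompl`), so `x` may be taken orthogonally indecomposable. By a Fitting
argument every self-adjoint element commuting with `x` is then nilpotent or injective. Applied to `T
+ T⁻¹ ∓ 2`, this leaves two cases: `x - x⁻¹` is injective, or `x` is `±1` times a unipotent.

In each case the last nonzero power `s` of a suitable nilpotent element, the socle, decides. If `s`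
is self-adjoint, some `v` has `B (s v) v ≠ 0`, and such a `v` generates `E`. If `s` is skew
(unipotent, even index), two generators are needed, with inverter `(a, b) ↦ (a*, -b*)`. The
determinant comes from an injective map anticommuting with the inverter (`det_involution`), or, in
odd dimension, from choosing between `g` and `-g`. -/

namespace MVW

open LaurentPolynomial Module

/-! ### Descent to quotients and determinants of involutions. -/

section LinearAlgebra

variable {K E : Type*} [Field K] [AddCommGroup E] [Module K E]

/-- An endomorphism of a module of generators that preserves the relations descends. -/
theorem exists_descend {F : Type*} [AddCommGroup F] [Module K F] (p : F →ₗ[K] E)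
    (hp : Function.Surjective p) (g : F →ₗ[K] F) (hg : ∀ f, p f = 0 → p (g f) = 0) :
    ∃ h : E →ₗ[K] E, ∀ f, h (p f) = p (g f) := by
  obtain ⟨s, hs⟩ := LinearMap.exists_rightInverse_of_surjective p (LinearMap.range_eq_top.2 hp)
  refine ⟨p ∘ₗ g ∘ₗ s, fun f => ?_⟩
  have h1 : p (s (p f) - f) = 0 := by
    rw [map_sub, sub_eq_zero]
    exact LinearMap.congr_fun hs (p f)
  have h2 := hg _ h1
  rw [map_sub, map_sub, sub_eq_zero] at h2
  exact h2

theorem det_of_isCompl [FiniteDimensional K E] {V W : Submodule K E} (h : IsCompl V W)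
    (g : E →ₗ[K] E) (gV : V →ₗ[K] V) (gW : W →ₗ[K] W)
    (hV : ∀ v : V, g v = gV v) (hW : ∀ w : W, g w = gW w) :
    LinearMap.det g = LinearMap.det gV * LinearMap.det gW := by
  rw [← LinearMap.det_prodMap, ← LinearMap.det_conj (gV.prodMap gW) (V.prodEquivOfIsCompl W h)]
  congr 1
  ext e
  obtain ⟨⟨v, w⟩, rfl⟩ := (V.prodEquivOfIsCompl W h).surjective e
  simp [Submodule.coe_prodEquivOfIsCompl', hV, hW]

/-- The determinant of an involution that anticommutes with an automorphism. -/
theorem det_involution [FiniteDimensional K E] [NeZero (2 : K)] (g : E →ₗ[K] E)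
    (hg : ∀ u, g (g u) = u) (J : E →ₗ[K] E) (hJ : Function.Injective J)
    (h : ∀ u, g (J u) = -J (g u)) :
    LinearMap.det g = (-1) ^ (finrank K E / 2) := by
  have h2 : (2 : K) ≠ 0 := NeZero.ne 2
  set V := LinearMap.ker (g - 1) with hV
  set W := LinearMap.ker (g + 1) with hW
  have memV (u : E) : u ∈ V ↔ g u = u := by
    simp [hV, LinearMap.mem_ker, sub_eq_zero]
  have memW (u : E) : u ∈ W ↔ g u = -u := by
    simp [hW, LinearMap.mem_ker, add_eq_zero_iff_eq_neg]
  have hc : IsCompl V W := by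
    constructor
    · rw [Submodule.disjoint_def]
      intro u hu hu'
      rw [memV] at hu
      rw [memW, hu] at hu'
      have : (2 : K) • u = 0 := by rw [two_smul]; exact add_eq_zero_iff_eq_neg.2 hu'
      exact (smul_eq_zero.1 this).resolve_left h2
    · rw [codisjoint_iff, Submodule.eq_top_iff']
      intro u
      have : u = (2 : K)⁻¹ • (u + g u) + (2 : K)⁻¹ • (u - g u) := by
        rw [← smul_add, add_add_sub_cancel, ← two_smul K u, smul_smul, inv_mul_cancel₀ h2,
          one_smul]
      rw [this]
      refine Submodule.add_mem_sup (V.smul_mem _ ?_) (W.smul_mem _ ?_)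
      · rw [memV, map_add, hg, add_comm]
      · rw [memW, map_sub, hg, neg_sub]
  -- Anticommuting with `g`, the injection `J` carries each eigenspace into the other.
  have hdim : finrank K V = finrank K W := by
    apply le_antisymm
    · refine LinearMap.finrank_le_finrank_of_injective
        (f := J.restrict (p := V) (q := W) fun u hu => ?_) ?_
      · rw [memW, h, (memV u).1 hu]
      · intro a b hab
        exact Subtype.ext (hJ (congrArg Subtype.val hab))
    · refine LinearMap.finrank_le_finrank_of_injective
        (f := J.restrict (p := W) (q := V) fun u hu => ?_) ?_
      · rw [memV, h, (memW u).1 hu, map_neg, neg_neg]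
      · intro a b hab
        exact Subtype.ext (hJ (congrArg Subtype.val hab))
  have hsum := Submodule.finrank_add_eq_of_isCompl hc
  rw [det_of_isCompl hc g LinearMap.id (-LinearMap.id) (fun v => (memV v).1 v.2)
    (fun w => (memW w).1 w.2), LinearMap.det_id, one_mul, ← hsum, hdim, ← two_mul,
    Nat.mul_div_cancel_left _ two_pos, ← neg_one_smul K, LinearMap.det_smul, LinearMap.det_id,
    mul_one]

end LinearAlgebra

/-! ### Polynomials in an element at which an irreducible polynomial is nilpotent. -/

section Polynomials

open Polynomial

variable {K R : Type*} [Field K] [Ring R] [Algebra K R]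

/-- If `f(y)` is nilpotent, an element prime to `f` is invertible at `y`. -/
theorem exists_aeval_mul_eq_one (y : R) {f h : K[X]} (hf : Irreducible f) {k : ℕ}
    (hk : aeval y f ^ k = 0) (hfh : ¬ f ∣ h) : ∃ r : K[X], aeval y r * aeval y h = 1 := by
  obtain ⟨u, w, huw⟩ := (IsCoprime.pow_left (m := k)
    (hf.coprime_iff_not_dvd.2 hfh) : IsCoprime (f ^ k) h)
  refine ⟨w, ?_⟩
  have := congrArg (aeval y) huw
  simpa [hk] using this

/-- A nonzero value `h(y)`, where `f(y)` is nilpotent, is up to a unit a power of `f(y)`. -/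
theorem exists_eq_pow_mul (y : R) {f h : K[X]} (hf : Irreducible f) {k : ℕ}
    (hk : aeval y f ^ k = 0) (hh : aeval y h ≠ 0) :
    ∃ (j : ℕ) (h' r : K[X]), j < k ∧ h = f ^ j * h' ∧ aeval y r * aeval y h' = 1 := by
  have h0 : h ≠ 0 := by rintro rfl; simp at hh
  obtain ⟨h', hh', hnd⟩ :=
    (FiniteMultiplicity.of_not_isUnit hf.not_isUnit h0).exists_eq_pow_mul_and_not_dvd
  obtain ⟨r, hr⟩ := exists_aeval_mul_eq_one y hf hk hnd
  refine ⟨_, h', r, ?_, hh', hr⟩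
  by_contra! hj
  apply hh
  rw [hh', map_mul, map_pow, pow_eq_zero_of_le hj hk, zero_mul]

/-- A nonzero value is a unit times `f(y) ^ j` with `j < k`; invert the unit and supply the missing
`k - 1 - j` factors. -/
theorem exists_aeval_mul_eq_pow (y : R) {f h : K[X]} (hf : Irreducible f) {k : ℕ}
    (hk : aeval y f ^ k = 0) (hh : aeval y h ≠ 0) :
    ∃ r : K[X], aeval y r * aeval y h = aeval y f ^ (k - 1) := by
  obtain ⟨j, h', r, hj, rfl, hr⟩ := exists_eq_pow_mul y hf hk hh
  refine ⟨f ^ (k - 1 - j) * r, ?_⟩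
  rw [← map_mul, show f ^ (k - 1 - j) * r * (f ^ j * h') = f ^ (k - 1 - j + j) * (r * h') by ring,
    map_mul, map_mul, hr, mul_one, map_pow, Nat.sub_add_cancel (by omega)]

/-- A nonzero value is `y ^ j` times a unit; being killed by `y` forces `j = k - 1`, and there only
the constant term of the cofactor survives. -/
theorem exists_eq_smul_pow (y : R) {k : ℕ} (hk : y ^ k = 0) (hk' : y ^ (k - 1) ≠ 0) (h : K[X])
    (hh : y * aeval y h = 0) : ∃ α : K, aeval y h = α • y ^ (k - 1) := by
  by_cases h0 : aeval y h = 0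
  · exact ⟨0, by rw [h0, zero_smul]⟩
  obtain ⟨j, h', r, hj, rfl, hr⟩ :=
    exists_eq_pow_mul y irreducible_X (k := k) (by rwa [aeval_X]) h0
  have hj' : y ^ (j + 1) = 0 := by
    have : aeval y (X * (X ^ j * h') * r) = 0 := by
      rw [map_mul, map_mul, aeval_X, hh, zero_mul]
    rw [show X * (X ^ j * h') * r = X ^ (j + 1) * (r * h') by ring, map_mul, map_mul, hr, mul_one,
      map_pow, aeval_X] at this
    exact this
  have hjk : j = k - 1 := by
    by_contra hne
    exact hk' (pow_eq_zero_of_le (by omega) hj')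
  refine ⟨h'.coeff 0, ?_⟩
  have hsplit : X ^ j * h' = X ^ (j + 1) * h'.divX + X ^ j * Polynomial.C (h'.coeff 0) := by
    conv_lhs => rw [← divX_mul_X_add h']
    ring
  rw [hsplit]
  rw [map_add, map_mul, map_pow, aeval_X, hj', zero_mul, zero_add, map_mul, map_pow, aeval_X,
    aeval_C, hjk, ← Algebra.commutes, Algebra.smul_def]

end Polynomials

/-! ### The action of Laurent polynomials and its adjoint. -/

section Action

variable {K E : Type*} [Field K] [AddCommGroup E] [Module K E]

/-- The action of Laurent polynomials on a vector space with an automorphism. -/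
noncomputable def laurentAction (x : E ≃ₗ[K] E) : K[T;T⁻¹] →ₐ[K] Module.End K E :=
  AddMonoidAlgebra.lift K (Module.End K E) ℤ
    ((LinearEquiv.automorphismGroup.toLinearMapMonoidHom (R := K) (M := E)).comp (zpowersHom _ x))

theorem laurentAction_T (x : E ≃ₗ[K] E) (n : ℤ) (u : E) :
    laurentAction x (T n) u = (x ^ n) u := by
  rw [laurentAction, T, AddMonoidAlgebra.lift_single, one_smul]
  rfl

theorem laurentAction_T_one (x : E ≃ₗ[K] E) (u : E) : laurentAction x (T 1) u = x u := by
  rw [laurentAction_T, zpow_one]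

theorem laurentAction_T_neg_one (x : E ≃ₗ[K] E) (u : E) :
    laurentAction x (T (-1)) u = x.symm u := by
  rw [laurentAction_T, zpow_neg_one]; rfl

theorem laurentAction_mul (x : E ≃ₗ[K] E) (a b : K[T;T⁻¹]) (u : E) :
    laurentAction x (a * b) u = laurentAction x a (laurentAction x b u) := by
  rw [map_mul]; rfl

theorem laurentAction_comm (x : E ≃ₗ[K] E) (a b : K[T;T⁻¹]) (u : E) :
    laurentAction x a (laurentAction x b u) = laurentAction x b (laurentAction x a u) := by
  rw [← laurentAction_mul, mul_comm, laurentAction_mul]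

theorem laurentAction_adjoint (B : LinearMap.BilinForm K E) (x : E ≃ₗ[K] E)
    (hx : ∀ u v, B (x u) (x v) = B u v) (a : K[T;T⁻¹]) (u v : E) :
    B (laurentAction x a u) v = B u (laurentAction x (invert a) v) := by
  have hz (n : ℤ) : ∀ u v, B ((x ^ n) u) ((x ^ n) v) = B u v :=
    ((orthogonalGroup B).zpow_mem (x := x) hx n : x ^ n ∈ orthogonalGroup B)
  induction a using LaurentPolynomial.induction_on' with
  | add p q hp hq => simp [hp, hq]
  | C_mul_T n r =>
    have := hz n u ((x ^ (-n)) v)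
    rw [← LinearEquiv.mul_apply, ← zpow_add, add_neg_cancel, zpow_zero] at this
    simp only [map_mul, invert_C, invert_T, Module.End.mul_apply, laurentAction_T]
    simp only [C_eq_algebraMap, AlgHom.commutes, Module.algebraMap_end_apply, map_smul,
      LinearMap.smul_apply]
    rw [← this]; rfl

end Action

universe u

/-! ### Reduction to orthogonally indecomposable isometries. -/

section Reduction

variable {K E : Type*} [Field K] [AddCommGroup E] [Module K E]

/-- There is an isometry, of determinant `(-1) ^ ⌊dim E / 2⌋`, conjugating `x` to its inverse. -/
def HasInverter (B : LinearMap.BilinForm K E) (x : E →ₗ[K] E) : Prop :=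
  ∃ g : E →ₗ[K] E, (∀ u v, B (g u) (g v) = B u v) ∧ (∀ u, x (g (x u)) = g u) ∧
    LinearMap.det g = (-1) ^ (finrank K E / 2)

/-- The only stable nondegenerate subspaces are the trivial ones. -/
def OrthogonallyIndecomposable (B : LinearMap.BilinForm K E) (x : E →ₗ[K] E) : Prop :=
  ∀ W : Submodule K E, (∀ u ∈ W, x u ∈ W) → (∀ u ∈ W, (∀ v ∈ W, B u v = 0) → u = 0) →
    W = ⊥ ∨ W = ⊤

theorem HasInverter.of_isCompl [FiniteDimensional K E] {B : LinearMap.BilinForm K E}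
    {x : E →ₗ[K] E} {V W : Submodule K E} (h : IsCompl V W)
    (hVW : ∀ v ∈ V, ∀ w ∈ W, B v w = 0) (hWV : ∀ w ∈ W, ∀ v ∈ V, B w v = 0)
    (hV : ∀ u ∈ V, x u ∈ V) (hW : ∀ u ∈ W, x u ∈ W)
    (iV : HasInverter (B.restrict V) (x.restrict hV))
    (iW : HasInverter (B.restrict W) (x.restrict hW)) : HasInverter B x := by
  obtain ⟨gV, hgV, hxV, hdV⟩ := iV
  obtain ⟨gW, hgW, hxW, hdW⟩ := iW
  have hsum := Submodule.finrank_add_eq_of_isCompl h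
  obtain ⟨gV', hgV', hxV', hd⟩ : ∃ g : V →ₗ[K] V,
      (∀ u v, B.restrict V (g u) (g v) = B.restrict V u v) ∧
      (∀ u, x.restrict hV (g (x.restrict hV u)) = g u) ∧
      LinearMap.det g * LinearMap.det gW = (-1) ^ (finrank K E / 2) := by
    -- The halves of the two dimensions, rounded down, add up to the half of the sum unless both are
    -- odd, when one is lost; negating `gV` on its odd-dimensional space restores the sign.
    by_cases hodd : Odd (finrank K V) ∧ Odd (finrank K W)
    · refine ⟨-gV, fun u v => ?_, fun u => ?_, ?_⟩
      · simpa using hgV u v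
      · simp [hxV u]
      · rw [← neg_one_smul K gV, LinearMap.det_smul, hdV, hdW, ← pow_add, ← pow_add, ← hsum]
        obtain ⟨⟨a, ha⟩, ⟨b, hb⟩⟩ := hodd
        rw [ha, hb, show (2 * a + 1 + (2 * b + 1)) / 2 = a + b + 1 by omega,
          show 2 * a + 1 + (2 * a + 1) / 2 + (2 * b + 1) / 2 = 2 * a + (a + b + 1) by omega,
          pow_add, pow_mul]
        simp
    · refine ⟨gV, hgV, hxV, ?_⟩
      rw [hdV, hdW, ← pow_add, ← hsum]
      congr 1
      rw [Nat.odd_iff, Nat.odd_iff] at hodd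
      omega
  set g := LinearMap.ofIsCompl h (V.subtype ∘ₗ gV') (W.subtype ∘ₗ gW) with hg
  have gl (v : V) : g v = gV' v := by simp [hg]
  have gr (w : W) : g w = gW w := by simp [hg]
  have hex (u : E) : ∃ (v : V) (w : W), u = v + w := by
    obtain ⟨v, hv, w, hw, rfl⟩ := Submodule.mem_sup.1 (h.sup_eq_top.symm ▸ Submodule.mem_top :
      u ∈ V ⊔ W)
    exact ⟨⟨v, hv⟩, ⟨w, hw⟩, rfl⟩
  refine ⟨g, fun u u' => ?_, fun u => ?_, ?_⟩
  · obtain ⟨v, w, rfl⟩ := hex u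
    obtain ⟨v', w', rfl⟩ := hex u'
    have h1 : B (gV' v) (gV' v') = B v v' := hgV' v v'
    have h2 : B (gW w) (gW w') = B w w' := hgW w w'
    simp only [map_add, LinearMap.add_apply, gl, gr, h1, h2, hVW _ v.2 _ w'.2, hWV _ w.2 _ v'.2,
      hVW _ (gV' v).2 _ (gW w').2, hWV _ (gW w).2 _ (gV' v').2]
  · obtain ⟨v, w, rfl⟩ := hex u
    have h1 : x (gV' (x.restrict hV v)) = gV' v := congrArg Subtype.val (hxV' v)
    have h2 : x (gW (x.restrict hW w)) = gW w := congrArg Subtype.val (hxW w)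
    have h3 : g (x v) = gV' (x.restrict hV v) := gl (x.restrict hV v)
    have h4 : g (x w) = gW (x.restrict hW w) := gr (x.restrict hW w)
    simp only [map_add, gl, gr, h3, h4, h1, h2]
  · rw [det_of_isCompl h g gV' gW gl gr, hd]

theorem isCompl_orthogonal [FiniteDimensional K E] {B : LinearMap.BilinForm K E}
    (hB : B.IsSymm) {W : Submodule K E} (hW : ∀ u ∈ W, (∀ v ∈ W, B u v = 0) → u = 0) :
    IsCompl W (B.orthogonal W) := by
  rw [LinearMap.BilinForm.isCompl_orthogonal_iff_disjoint hB.isRefl, Submodule.disjoint_def]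
  intro u hu hu'
  exact hW u hu fun v hv => by rw [hB.eq]; exact hu' v hv

/-- Induction on the dimension reduces to orthogonally indecomposable isometries. -/
theorem hasInverter_of_indecomposable {K : Type*} [Field K] {n : ℕ}
    (step : ∀ (E : Type u) [AddCommGroup E] [Module K E] [FiniteDimensional K E]
      (B : LinearMap.BilinForm K E) (x : E →ₗ[K] E), B.IsSymm → (∀ u, (∀ v, B u v = 0) → u = 0) →
      (∀ u v, B (x u) (x v) = B u v) → OrthogonallyIndecomposable B x → HasInverter B x)
    (E : Type u) [AddCommGroup E] [Module K E] [FiniteDimensional K E]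
    (B : LinearMap.BilinForm K E) (x : E →ₗ[K] E) (hB : B.IsSymm)
    (hnd : ∀ u, (∀ v, B u v = 0) → u = 0) (hx : ∀ u v, B (x u) (x v) = B u v)
    (hn : finrank K E = n) : HasInverter B x := by
  induction n using Nat.strong_induction_on generalizing E with
  | _ n ih =>
  by_cases hind : OrthogonallyIndecomposable B x
  · exact step E B x hB hnd hx hind
  simp only [OrthogonallyIndecomposable, not_forall, not_or] at hind
  obtain ⟨W, hxW, hW, hbot, htop⟩ := hind
  have hc := isCompl_orthogonal hB hW
  have hsum := Submodule.finrank_add_eq_of_isCompl hc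
  have hlt : finrank K W < finrank K E := Submodule.finrank_lt htop
  have hpos : 0 < finrank K W :=
    Nat.pos_of_ne_zero fun h => hbot (Submodule.finrank_eq_zero.1 h)
  have hWo : ∀ v ∈ W, ∀ w ∈ B.orthogonal W, B v w = 0 := fun v hv w hw => hw v hv
  have hoW : ∀ w ∈ B.orthogonal W, ∀ v ∈ W, B w v = 0 := fun w hw v hv => by
    rw [hB.eq]; exact hw v hv
  have hinj : Function.Injective x := by
    rw [injective_iff_map_eq_zero]
    intro u hu
    refine hnd u fun v => ?_
    rw [← hx, hu, map_zero, LinearMap.zero_apply]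
  have hsurj : ∀ w ∈ W, ∃ w' ∈ W, x w' = w := by
    have : Function.Surjective (x.restrict hxW) := by
      rw [← LinearMap.injective_iff_surjective]
      exact fun a b hab => Subtype.ext (hinj (congrArg Subtype.val hab))
    intro w hw
    obtain ⟨w', hw'⟩ := this ⟨w, hw⟩
    exact ⟨w', w'.2, congrArg Subtype.val hw'⟩
  have hxo : ∀ u ∈ B.orthogonal W, x u ∈ B.orthogonal W := by
    intro u hu w hw
    obtain ⟨w', hw', rfl⟩ := hsurj w hw
    change B (x w') (x u) = 0
    rw [hx]
    exact hu w' hw'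
  refine HasInverter.of_isCompl hc hWo hoW hxW hxo ?_ ?_
  · refine ih _ (by omega) W (B.restrict W) _ ⟨fun u v => hB.eq _ _⟩ (fun u hu => ?_)
      (fun u v => hx u v) rfl
    exact Subtype.ext (hW u u.2 fun v hv => hu ⟨v, hv⟩)
  · refine ih _ (by omega) (B.orthogonal W) (B.restrict _) _ ⟨fun u v => hB.eq _ _⟩
      (fun u hu => ?_) (fun u v => hx u v) rfl
    refine Subtype.ext (hnd u fun v => ?_)
    obtain ⟨a, ha, b, hb, rfl⟩ := Submodule.mem_sup.1 (hc.sup_eq_top.symm ▸ Submodule.mem_top :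
      v ∈ W ⊔ B.orthogonal W)
    rw [map_add, hoW u u.2 a ha, zero_add]
    exact hu ⟨b, hb⟩

/-- A self-adjoint endomorphism commuting with an orthogonally indecomposable one is nilpotent
or injective. -/
theorem OrthogonallyIndecomposable.isNilpotent_or_injective [FiniteDimensional K E]
    {B : LinearMap.BilinForm K E} {x : E →ₗ[K] E} (hind : OrthogonallyIndecomposable B x)
    (hnd : ∀ u, (∀ v, B u v = 0) → u = 0) (y : Module.End K E)
    (hy : ∀ u v, B (y u) v = B u (y v)) (hxy : ∀ u, y (x u) = x (y u)) :
    IsNilpotent y ∨ Function.Injective y := by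
  -- Large enough for the kernels of powers to be stationary, and positive even when `E = 0`, so
  -- that injectivity of `y ^ n` passes to `y`.
  set n := finrank K E + 1
  have hadj (m : ℕ) : ∀ u v, B ((y ^ m) u) v = B u ((y ^ m) v) := by
    induction m with
    | zero => simp
    | succ m ih =>
      intro u v
      rw [pow_succ, Module.End.mul_apply, ih, hy, ← Module.End.mul_apply, ← pow_succ', pow_succ]
  have hcomm : ∀ u, (y ^ n) (x u) = x ((y ^ n) u) := fun u =>
    LinearMap.congr_fun (((show Commute y x from LinearMap.ext hxy).pow_left n).eq) u
  have hker : ∀ u, (y ^ n) ((y ^ n) u) = 0 → (y ^ n) u = 0 := by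
    intro u hu
    rw [← Module.End.mul_apply, ← pow_add] at hu
    have h1 := Module.End.ker_pow_eq_ker_pow_finrank_of_le (f := y) (m := n + n) (by omega)
    have h2 := Module.End.ker_pow_eq_ker_pow_finrank_of_le (f := y) (m := n) (by omega)
    rw [← LinearMap.mem_ker, h2, ← h1]
    exact hu
  have hstable : ∀ u ∈ LinearMap.range (y ^ n), x u ∈ LinearMap.range (y ^ n) := by
    rintro _ ⟨u, rfl⟩
    exact ⟨x u, hcomm u⟩
  -- If `y ^ n u` is orthogonal to the range, self-adjointness makes `y ^ n (y ^ n u)` orthogonal to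
  -- all of `E`, hence zero.
  have hnondeg : ∀ u ∈ LinearMap.range (y ^ n),
      (∀ v ∈ LinearMap.range (y ^ n), B u v = 0) → u = 0 := by
    rintro _ ⟨u, rfl⟩ hu
    apply hker
    refine hnd _ fun v => ?_
    rw [hadj]
    exact hu _ ⟨v, rfl⟩
  rcases hind _ hstable hnondeg with h | h
  · exact Or.inl ⟨n, LinearMap.range_eq_bot.1 h⟩
  · right
    have hinj := LinearMap.injective_iff_surjective.2 (LinearMap.range_eq_top.1 h)
    rw [injective_iff_map_eq_zero]
    intro u hu
    apply hinj
    rw [map_zero, pow_succ, Module.End.mul_apply, hu, map_zero]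

end Reduction

/-! ### Symmetric Laurent polynomials and cyclic isometries. -/

section Laurent

variable {K E : Type*} [Field K] [AddCommGroup E] [Module K E]

/-- The orbit map of a vector under the action of Laurent polynomials. -/
noncomputable def orbitMap (x : E ≃ₗ[K] E) (v : E) : K[T;T⁻¹] →ₗ[K] E :=
  (LinearMap.applyₗ v) ∘ₗ (laurentAction x).toLinearMap

theorem orbitMap_apply (x : E ≃ₗ[K] E) (v : E) (a : K[T;T⁻¹]) :
    orbitMap x v a = laurentAction x a v := rfl

/-- On monomials this is the Chebyshev recurrence: multiplying `Tⁿ⁺¹ + T⁻ⁿ⁻¹` by `T + T⁻¹` gives the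
next sum plus the previous one. -/
theorem exists_symmetrization_eq_aeval (a : K[T;T⁻¹]) :
    ∃ h : Polynomial K, a + invert a = Polynomial.aeval (T 1 + T (-1) : K[T;T⁻¹]) h := by
  have hnat (n : ℕ) : ∃ h : Polynomial K,
      (T n + T (-n) : K[T;T⁻¹]) = Polynomial.aeval (T 1 + T (-1) : K[T;T⁻¹]) h := by
    induction n using Nat.twoStepInduction with
    | zero => exact ⟨2, by simp [one_add_one_eq_two, map_ofNat]⟩
    | one => exact ⟨Polynomial.X, by simp⟩
    | more n h1 h2 =>
      obtain ⟨p, hp⟩ := h1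
      obtain ⟨q, hq⟩ := h2
      refine ⟨Polynomial.X * q - p, ?_⟩
      rw [map_sub, map_mul, Polynomial.aeval_X, ← hp, ← hq]
      simp only [add_mul, mul_add, ← T_add]
      push_cast
      ring_nf
  have hint (n : ℤ) : ∃ h : Polynomial K,
      (T n + T (-n) : K[T;T⁻¹]) = Polynomial.aeval (T 1 + T (-1) : K[T;T⁻¹]) h := by
    obtain ⟨m, rfl | rfl⟩ := n.eq_nat_or_neg
    · exact hnat m
    · obtain ⟨h, hh⟩ := hnat m
      exact ⟨h, by rw [neg_neg, add_comm, hh]⟩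
  induction a using LaurentPolynomial.induction_on' with
  | add p q hp hq =>
    obtain ⟨h, hh⟩ := hp
    obtain ⟨h', hh'⟩ := hq
    exact ⟨h + h', by rw [map_add, map_add, ← hh, ← hh']; ring⟩
  | C_mul_T n r =>
    obtain ⟨h, hh⟩ := hint n
    refine ⟨Polynomial.C r * h, ?_⟩
    rw [map_mul, invert_C, invert_T, map_mul, ← hh, Polynomial.aeval_C, ← C_eq_algebraMap]
    ring

variable {B : LinearMap.BilinForm K E} {x : E ≃ₗ[K] E}

theorem laurentAction_invert_eq_zero (hB : B.IsSymm) (hnd : ∀ u, (∀ v, B u v = 0) → u = 0)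
    (hx : ∀ u v, B (x u) (x v) = B u v) {a : K[T;T⁻¹]} (ha : laurentAction x a = 0) :
    laurentAction x (invert a) = 0 := by
  ext u
  refine hnd _ fun v => ?_
  rw [hB.eq, ← laurentAction_adjoint B x hx, ha, LinearMap.zero_apply, map_zero,
    LinearMap.zero_apply]

theorem laurentAction_invert_invert (hx : ∀ u v, B (x u) (x v) = B u v) (a b : K[T;T⁻¹])
    (u w : E) : B (laurentAction x (invert a) u) (laurentAction x (invert b) w) =
      B (laurentAction x b u) (laurentAction x a w) := by
  rw [laurentAction_adjoint B x hx, laurentAction_adjoint B x hx, involutive_invert,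
    laurentAction_comm]

/-- Polarisation: `B (s u) w` is a nonzero symmetric form, so its quadratic form cannot vanish when
`2` is invertible. -/
theorem exists_apply_self_ne_zero [NeZero (2 : K)] (hB : B.IsSymm)
    (hnd : ∀ u, (∀ v, B u v = 0) → u = 0) {s : Module.End K E}
    (hs : ∀ u v, B (s u) v = B u (s v)) (h0 : s ≠ 0) : ∃ v, B (s v) v ≠ 0 := by
  by_contra! h
  apply h0
  ext u
  refine hnd _ fun w => ?_
  have h1 := h (u + w)
  simp only [map_add, LinearMap.add_apply, h u, h w, zero_add, add_zero] at h1
  rw [hs w u, hB.eq w, ← two_mul] at h1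
  exact (mul_eq_zero.1 h1).resolve_left (NeZero.ne 2)

theorem eq_top_of_stable (hind : OrthogonallyIndecomposable B (x : E →ₗ[K] E))
    {F : Type*} [AddCommGroup F] [Module K F] (p : F →ₗ[K] E) (h0 : p ≠ 0)
    (hx : ∀ f, ∃ f', p f' = x (p f)) (h : ∀ f, (∀ f', B (p f) (p f') = 0) → p f = 0) :
    Function.Surjective p := by
  rw [← LinearMap.range_eq_top]
  refine (hind (LinearMap.range p) ?_ ?_).resolve_left fun hb => h0 (LinearMap.range_eq_bot.1 hb)
  · rintro _ ⟨f, rfl⟩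
    exact hx f
  · rintro _ ⟨f, rfl⟩ hf
    exact h f fun f' => hf _ ⟨f', rfl⟩

/-- A cyclic isometry is inverted by the isometric involution induced by `T ↦ T⁻¹`. -/
theorem exists_inverter_of_cyclic (hB : B.IsSymm) (hnd : ∀ u, (∀ v, B u v = 0) → u = 0)
    (hx : ∀ u v, B (x u) (x v) = B u v) {v : E}
    (hind : OrthogonallyIndecomposable B (x : E →ₗ[K] E)) (hv : v ≠ 0)
    (hfree : ∀ a, (∀ b, B (laurentAction x a v) (laurentAction x b v) = 0) →
      laurentAction x a = 0) :
    Function.Surjective (orbitMap x v) ∧ ∃ g : E →ₗ[K] E, (∀ u w, B (g u) (g w) = B u w) ∧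
      (∀ a u, g (laurentAction x a u) = laurentAction x (invert a) (g u)) ∧
      ∀ u, g (g u) = u := by
  have hsurj : Function.Surjective (orbitMap x v) := by
    refine eq_top_of_stable (B := B) hind _ (fun h => hv ?_) (fun a => ⟨T 1 * a, ?_⟩) fun a ha => ?_
    · have := LinearMap.congr_fun h 1
      rwa [orbitMap_apply, map_one] at this
    · rw [orbitMap_apply, laurentAction_mul, laurentAction_T_one, orbitMap_apply]
    · rw [orbitMap_apply, hfree a ha, LinearMap.zero_apply]
  refine ⟨hsurj, ?_⟩
  -- Well defined: `a v = 0` forces `a` to act as zero by `hfree`, and then its adjoint does too.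
  obtain ⟨g, hg⟩ := exists_descend (orbitMap x v) hsurj (invert (R := K)).toLinearMap fun a ha => by
    have : laurentAction x a = 0 := hfree a fun b => by
      rw [← orbitMap_apply, ha, map_zero, LinearMap.zero_apply]
    exact LinearMap.congr_fun (laurentAction_invert_eq_zero hB hnd hx this) v
  replace hg (a) : g (laurentAction x a v) = laurentAction x (invert a) v := hg a
  have hex (u : E) : ∃ a, laurentAction x a v = u := hsurj u
  refine ⟨g, fun u w => ?_, fun a u => ?_, fun u => ?_⟩
  · obtain ⟨a, rfl⟩ := hex u
    obtain ⟨b, rfl⟩ := hex w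
    rw [hg, hg, laurentAction_invert_invert hx, hB.eq]
  · obtain ⟨b, rfl⟩ := hex u
    rw [← laurentAction_mul, hg, hg, map_mul, laurentAction_mul]
  · obtain ⟨a, rfl⟩ := hex u
    rw [hg, hg, involutive_invert]

end Laurent

/-! ### The case where `x - x⁻¹` is injective. -/

section Cases

variable {K E : Type*} [Field K] [AddCommGroup E] [Module K E]

/-- Any irreducible factor of the minimal polynomial works: were its value injective, the cofactor
would already annihilate `t`. -/
theorem exists_irreducible_not_injective [FiniteDimensional K E] [Nontrivial E] (t : Module.End K E) :
    ∃ f : Polynomial K, Irreducible f ∧ ¬ Function.Injective (Polynomial.aeval t f) := by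
  have hint := Algebra.IsIntegral.isIntegral (R := K) t
  obtain ⟨f, hf, q, hq⟩ := WfDvdMonoid.exists_irreducible_factor (minpoly.not_isUnit K t)
    (minpoly.ne_zero hint)
  refine ⟨f, hf, fun hinj => ?_⟩
  have hq0 : q ≠ 0 := by
    rintro rfl
    exact minpoly.ne_zero hint (by rw [hq, mul_zero])
  have haq : Polynomial.aeval t q = 0 := by
    ext u
    apply hinj
    rw [← Module.End.mul_apply, ← map_mul, ← hq, minpoly.aeval, LinearMap.zero_apply,
      map_zero]
  have hdvd := minpoly.dvd K t haq
  rw [hq] at hdvd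
  obtain ⟨r, hr⟩ := hdvd
  refine hf.not_isUnit (IsUnit.of_mul_eq_one r (mul_left_cancel₀ hq0 ?_))
  rw [mul_one]
  conv_rhs => rw [hr]
  ring

variable {B : LinearMap.BilinForm K E} {x : E ≃ₗ[K] E}

theorem OrthogonallyIndecomposable.laurent_isNilpotent_or_injective
    [FiniteDimensional K E]
    (hind : OrthogonallyIndecomposable B (x : E →ₗ[K] E)) (hnd : ∀ u, (∀ v, B u v = 0) → u = 0)
    (hx : ∀ u v, B (x u) (x v) = B u v) {a : K[T;T⁻¹]} (ha : invert a = a) :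
    IsNilpotent (laurentAction x a) ∨ Function.Injective (laurentAction x a) := by
  refine hind.isNilpotent_or_injective hnd _ (fun u v => ?_) fun u => ?_
  · rw [laurentAction_adjoint B x hx, ha]
  · simp only [LinearEquiv.coe_coe]
    rw [← laurentAction_T_one, laurentAction_comm, laurentAction_T_one]

theorem laurentAction_aeval (a : K[T;T⁻¹]) (h : Polynomial K) :
    laurentAction x (Polynomial.aeval a h) = Polynomial.aeval (laurentAction x a) h :=
  (Polynomial.aeval_algHom_apply (laurentAction x) a h).symm

theorem apply_inverter {g : E →ₗ[K] E}
    (hg : ∀ a u, g (laurentAction x a u) = laurentAction x (invert a) (g u)) (u : E) :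
    (x : E →ₗ[K] E) (g ((x : E →ₗ[K] E) u)) = g u := by
  have h := hg (T 1) u
  rw [invert_T, laurentAction_T_one, laurentAction_T_neg_one] at h
  simp only [LinearEquiv.coe_coe]
  rw [h, LinearEquiv.apply_symm_apply]

/-- With `t = x + x⁻¹`, some irreducible `f` has `f(t)` nilpotent. Its last nonzero power is
self-adjoint and provides a cyclic vector; the resulting involution anticommutes with `x - x⁻¹`,
which fixes its determinant. -/
theorem hasInverter_of_injective [NeZero (2 : K)] [FiniteDimensional K E] [Nontrivial E]
    (hB : B.IsSymm)
    (hnd : ∀ u, (∀ v, B u v = 0) → u = 0) (hx : ∀ u v, B (x u) (x v) = B u v)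
    (hind : OrthogonallyIndecomposable B (x : E →ₗ[K] E))
    (hy : Function.Injective (laurentAction x (T 1 - T (-1)))) :
    HasInverter B (x : E →ₗ[K] E) := by
  set t : K[T;T⁻¹] := T 1 + T (-1) with ht
  have htinv : invert t = t := by
    rw [ht, map_add, invert_T, invert_T, neg_neg, add_comm]
  have hinv (h : Polynomial K) : invert (Polynomial.aeval t h) = Polynomial.aeval t h := by
    have := (Polynomial.aeval_algHom_apply (invert (R := K)).toAlgHom t h).symm
    change invert (Polynomial.aeval t h) = Polynomial.aeval (invert t) h at this
    rwa [htinv] at this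
  obtain ⟨f, hf, hfi⟩ := exists_irreducible_not_injective (laurentAction x t)
  have hnil : IsNilpotent (Polynomial.aeval (laurentAction x t) f) := by
    rw [← laurentAction_aeval] at hfi ⊢
    exact (hind.laurent_isNilpotent_or_injective hnd hx (hinv f)).resolve_right hfi
  set k := nilpotencyClass (Polynomial.aeval (laurentAction x t) f)
  have hk : Polynomial.aeval (laurentAction x t) f ^ k = 0 := pow_nilpotencyClass hnil
  have hk' : Polynomial.aeval (laurentAction x t) f ^ (k - 1) ≠ 0 := pow_pred_nilpotencyClass hnil
  have hs : laurentAction x (Polynomial.aeval t (f ^ (k - 1))) =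
    Polynomial.aeval (laurentAction x t) f ^ (k - 1) := by
    rw [laurentAction_aeval, map_pow]
  rw [← hs] at hk'
  obtain ⟨v, hv⟩ := exists_apply_self_ne_zero hB hnd (fun u w => by
    rw [laurentAction_adjoint B x hx, hinv]) hk'
  -- `a + a*` is a polynomial in `t`; if it acted nontrivially, a multiple of it would be the socle,
  -- contradicting `B (s v) v ≠ 0`.
  have hsym : ∀ a, (∀ b, B (laurentAction x a v) (laurentAction x b v) = 0) →
      laurentAction x (a + invert a) = 0 := by
    intro a ha
    by_contra hne
    obtain ⟨h, hh⟩ := exists_symmetrization_eq_aeval a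
    rw [hh, laurentAction_aeval] at hne
    obtain ⟨r, hr⟩ := exists_aeval_mul_eq_pow _ hf hk hne
    rw [← laurentAction_aeval, ← laurentAction_aeval, ← hh, ← hs, ← map_mul] at hr
    have h1 (c) : B (laurentAction x (c * a) v) v = 0 := by
      rw [laurentAction_mul, laurentAction_adjoint B x hx, ha]
    have h2 (c) : B (laurentAction x (c * invert a) v) v = 0 := by
      rw [laurentAction_adjoint B x hx, hB.eq, map_mul, involutive_invert, h1]
    apply hv
    rw [← hr, mul_add, map_add, LinearMap.add_apply, map_add, LinearMap.add_apply, h1, h2,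
      add_zero]
  have hfree : ∀ a, (∀ b, B (laurentAction x a v) (laurentAction x b v) = 0) →
      laurentAction x a = 0 := by
    intro a ha
    have h1 := hsym a ha
    -- Multiplying by the anti-invariant `T - T⁻¹` turns the symmetrisation into `a - a*`; both
    -- parts of `a` then act as zero.
    have h2 := hsym ((T 1 - T (-1)) * a) fun b => by
      rw [laurentAction_mul, laurentAction_adjoint B x hx, ← laurentAction_mul, ha]
    rw [show (T 1 - T (-1)) * a + invert ((T 1 - T (-1)) * a) =
      (T 1 - T (-1)) * (a - invert a) by
        rw [map_mul, map_sub, invert_T, invert_T, neg_neg]; ring] at h2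
    have h3 : laurentAction x (a - invert a) = 0 := by
      ext u
      apply hy
      rw [← laurentAction_mul, h2, LinearMap.zero_apply, map_zero]
    have h4 : (2 : K) • laurentAction x a = 0 := by
      rw [two_smul, ← map_add, show a + a = (a + invert a) + (a - invert a) by ring, map_add, h1,
        h3, add_zero]
    exact (smul_eq_zero.1 h4).resolve_left (NeZero.ne 2)
  obtain ⟨-, g, hg, hgx, hgg⟩ := exists_inverter_of_cyclic hB hnd hx hind
    (by rintro rfl; simp at hv) hfree
  refine ⟨g, hg, apply_inverter hgx, det_involution g hgg _ hy fun u => ?_⟩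
  rw [hgx, map_sub, invert_T, invert_T, neg_neg, ← LinearMap.neg_apply, ← map_neg, neg_sub]

end Cases

/-! ### The algebra generated by `±1` times a unipotent isometry. -/

section Unipotent

variable {K E : Type*} [Field K] [AddCommGroup E] [Module K E]
variable {B : LinearMap.BilinForm K E} {x : E ≃ₗ[K] E} {ε : K}

theorem invert_T_sub_C_pow (hε : ε * ε = 1) (m : ℕ) :
    invert ((T 1 - C ε : K[T;T⁻¹]) ^ m) = (-(C ε * T (-1))) ^ m * (T 1 - C ε) ^ m := by
  have h : (C ε * C ε : K[T;T⁻¹]) = 1 := by rw [← map_mul, hε, map_one]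
  have h' : (T (-1) * T 1 : K[T;T⁻¹]) = 1 := by rw [← T_add, neg_add_cancel, T_zero]
  rw [map_pow, map_sub, invert_T, invert_C, ← mul_pow]
  congr 1
  linear_combination (-C ε) * h' * (-1) - T (-1) * h

/-- The adjoint of `x - ε` is `-ε x⁻¹ (x - ε)`. On the image of `(x - ε) ^ (k - 1)` the map `x` is
`ε`, so each of the `k - 1` factors `-ε x⁻¹` contributes `-1`. -/
theorem laurentAction_invert_socle (hε : ε * ε = 1) {k : ℕ} (hk : 0 < k)
    (hnil : laurentAction x (T 1 - C ε) ^ k = 0) (u : E) :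
    laurentAction x (invert ((T 1 - C ε) ^ (k - 1))) u =
      (-1 : K) ^ (k - 1) • laurentAction x ((T 1 - C ε) ^ (k - 1)) u := by
  have h0 : laurentAction x ((T 1 - C ε) * (T 1 - C ε) ^ (k - 1)) = 0 := by
    rw [← pow_succ', Nat.sub_add_cancel hk, map_pow, hnil]
  set s : K[T;T⁻¹] := (T 1 - C ε) ^ (k - 1) with hs
  have h1 : laurentAction x (-(C ε * T (-1)) * s) = (-1 : K) • laurentAction x s := by
    have h2 : -(C ε * T (-1)) * s = C (-1) * s + T (-1) * ((T 1 - C ε) * s) := by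
      have h' : (T (-1) * T 1 : K[T;T⁻¹]) = 1 := by rw [← T_add, neg_add_cancel, T_zero]
      rw [map_neg, map_one]
      linear_combination -s * h'
    rw [h2, map_add, map_mul _ (T (-1)), h0, mul_zero, add_zero, ← smul_eq_C_mul, map_smul]
  have h3 (m : ℕ) : laurentAction x ((-(C ε * T (-1))) ^ m * s) =
      (-1 : K) ^ m • laurentAction x s := by
    induction m with
    | zero => simp
    | succ m ih =>
      rw [pow_succ', mul_assoc, mul_left_comm, map_mul, h1, mul_smul_comm, ← map_mul, ih,
        smul_smul, pow_succ']
  rw [hs, invert_T_sub_C_pow hε, ← hs, h3, LinearMap.smul_apply]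

/-- With `N = x - ε` one has `x = N + ε`, and `x⁻¹` is a polynomial in the nilpotent `N` because `X
+ ε` is prime to `X`. -/
theorem laurentAction_eq_aeval (hε : ε ≠ 0) {k : ℕ}
    (hnil : laurentAction x (T 1 - C ε) ^ k = 0) (a : K[T;T⁻¹]) :
    ∃ h : Polynomial K, laurentAction x a = Polynomial.aeval (laurentAction x (T 1 - C ε)) h := by
  set N := laurentAction x (T 1 - C ε) with hN
  obtain ⟨p, hp⟩ : ∃ p : Polynomial K, laurentAction x (T 1) = Polynomial.aeval N p := by
    refine ⟨Polynomial.X + Polynomial.C ε, ?_⟩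
    rw [map_add, Polynomial.aeval_X, Polynomial.aeval_C, hN, map_sub, C_eq_algebraMap,
      AlgHom.commutes, sub_add_cancel]
  obtain ⟨q, hq⟩ : ∃ q : Polynomial K, laurentAction x (T (-1)) = Polynomial.aeval N q := by
    obtain ⟨r, hr⟩ := exists_aeval_mul_eq_one N Polynomial.irreducible_X (k := k)
      (h := Polynomial.X + Polynomial.C ε) (by rwa [Polynomial.aeval_X])
      (by rw [Polynomial.X_dvd_iff]; simpa using hε)
    refine ⟨r, ?_⟩
    rw [map_add, Polynomial.aeval_X, Polynomial.aeval_C] at hr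
    have h1 : N + algebraMap K (Module.End K E) ε = laurentAction x (T 1) := by
      rw [hN, map_sub, C_eq_algebraMap, AlgHom.commutes, sub_add_cancel]
    rw [h1] at hr
    rw [← one_mul (laurentAction x (T (-1))), ← hr, mul_assoc, ← map_mul, ← T_add,
      add_neg_cancel, T_zero, map_one, mul_one]
  induction a using LaurentPolynomial.induction_on' with
  | add a b ha hb =>
    obtain ⟨h, hh⟩ := ha
    obtain ⟨h', hh'⟩ := hb
    exact ⟨h + h', by rw [map_add, map_add, hh, hh']⟩
  | C_mul_T n r =>
    obtain ⟨m, rfl | rfl⟩ := n.eq_nat_or_neg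
    · refine ⟨Polynomial.C r * p ^ m, ?_⟩
      rw [map_mul, map_mul, map_pow, ← hp, Polynomial.aeval_C, C_eq_algebraMap, AlgHom.commutes,
        ← map_pow, T_pow, mul_one]
    · refine ⟨Polynomial.C r * q ^ m, ?_⟩
      rw [map_mul, map_mul, map_pow, ← hq, Polynomial.aeval_C, C_eq_algebraMap, AlgHom.commutes,
        ← map_pow, T_pow, mul_neg_one]

/-- Every nonzero element of the algebra generated by a unipotent isometry divides the socle. -/
theorem exists_laurentAction_mul_eq_socle (hε : ε ≠ 0) {k : ℕ}
    (hnil : laurentAction x (T 1 - C ε) ^ k = 0) {a : K[T;T⁻¹]} (ha : laurentAction x a ≠ 0) :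
    ∃ b, laurentAction x (b * a) = laurentAction x ((T 1 - C ε) ^ (k - 1)) := by
  obtain ⟨h, hh⟩ := laurentAction_eq_aeval hε hnil a
  rw [hh] at ha
  obtain ⟨r, hr⟩ := exists_aeval_mul_eq_pow _ Polynomial.irreducible_X (k := k)
    (by rwa [Polynomial.aeval_X]) ha
  refine ⟨Polynomial.aeval (T 1 - C ε) r, ?_⟩
  rw [map_mul, laurentAction_aeval, hh, hr, Polynomial.aeval_X, map_pow]

variable [FiniteDimensional K E]

/-- Remainders modulo `X ^ k` bound the dimension above. If it were below `k`, the kernels of `N ^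
(k - 1)` and `N ^ k` would already agree. -/
theorem finrank_eq_of_cyclic (hε : ε ≠ 0) {k : ℕ}
    (hnil : laurentAction x (T 1 - C ε) ^ k = 0)
    (hnil' : laurentAction x (T 1 - C ε) ^ (k - 1) ≠ 0) {v : E}
    (hv : Function.Surjective (orbitMap x v)) : finrank K E = k := by
  set N := laurentAction x (T 1 - C ε) with hN
  have hle : finrank K E ≤ k := by
    have hsurj : Function.Surjective (((LinearMap.applyₗ v) ∘ₗ (Polynomial.aeval N).toLinearMap) ∘ₗ
        (Polynomial.degreeLT K k).subtype) := by
      intro u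
      obtain ⟨a, rfl⟩ := hv u
      obtain ⟨h, hh⟩ := laurentAction_eq_aeval hε hnil a
      refine ⟨⟨h %ₘ Polynomial.X ^ k, ?_⟩, ?_⟩
      · rw [Polynomial.mem_degreeLT]
        refine (Polynomial.degree_modByMonic_lt _ (Polynomial.monic_X_pow k)).trans_eq ?_
        rw [Polynomial.degree_X_pow]
      · have := Polynomial.modByMonic_add_div h (Polynomial.X ^ k)
        have h2 : Polynomial.aeval N h = Polynomial.aeval N (h %ₘ Polynomial.X ^ k) := by
          conv_lhs => rw [← this]
          rw [map_add, map_mul, map_pow, Polynomial.aeval_X, hnil, zero_mul, add_zero]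
        rw [orbitMap_apply, hh, h2]
        rfl
    have : Module.Finite K (Polynomial.degreeLT K k) :=
      Module.Finite.equiv (Polynomial.degreeLTEquiv K k).symm
    refine (LinearMap.finrank_le_finrank_of_surjective hsurj).trans_eq ?_
    rw [(Polynomial.degreeLTEquiv K k).finrank_eq, finrank_fin_fun]
  refine le_antisymm hle ?_
  by_contra! hlt
  apply hnil'
  have h1 := Module.End.ker_pow_eq_ker_pow_finrank_of_le (f := N) hle
  have h2 := Module.End.ker_pow_eq_ker_pow_finrank_of_le (f := N) (m := k - 1) (by omega)
  rw [← LinearMap.ker_eq_top, h2, ← h1, hnil, LinearMap.ker_zero]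

end Unipotent

/-! ### Inverters in the unipotent case, by parity of the nilpotency index. -/

section UnipotentInverter

variable {K E : Type*} [Field K] [AddCommGroup E] [Module K E]
variable {B : LinearMap.BilinForm K E} {x : E ≃ₗ[K] E} {ε : K}

/-- For a unipotent isometry of odd nilpotency index, an indecomposable space is cyclic. -/
theorem hasInverter_of_odd [NeZero (2 : K)] [FiniteDimensional K E] (hB : B.IsSymm)
    (hnd : ∀ u, (∀ v, B u v = 0) → u = 0) (hx : ∀ u v, B (x u) (x v) = B u v)
    (hind : OrthogonallyIndecomposable B (x : E →ₗ[K] E)) (hε : ε * ε = 1) {k : ℕ} (hk : Odd k)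
    (hnil : laurentAction x (T 1 - C ε) ^ k = 0)
    (hnil' : laurentAction x (T 1 - C ε) ^ (k - 1) ≠ 0) : HasInverter B (x : E →ₗ[K] E) := by
  have hε0 : ε ≠ 0 := by rintro rfl; simp at hε
  have heven : Even (k - 1) := Nat.Odd.sub_odd hk odd_one
  have hinv (u) := laurentAction_invert_socle hε hk.pos hnil u
  simp only [heven.neg_one_pow, one_smul] at hinv
  rw [← map_pow] at hnil'
  obtain ⟨v, hv⟩ := exists_apply_self_ne_zero hB hnd (fun u w => by
    rw [laurentAction_adjoint B x hx, hinv]) hnil'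
  have hfree : ∀ a, (∀ b, B (laurentAction x a v) (laurentAction x b v) = 0) →
      laurentAction x a = 0 := by
    intro a ha
    by_contra hne
    obtain ⟨b, hb⟩ := exists_laurentAction_mul_eq_socle hε0 hnil hne
    apply hv
    rw [← hb, laurentAction_mul, laurentAction_adjoint B x hx, ha]
  obtain ⟨hsurj, g, hg, hgx, hgg⟩ := exists_inverter_of_cyclic hB hnd hx hind
    (by rintro rfl; simp at hv) hfree
  rw [map_pow] at hnil'
  have hn := finrank_eq_of_cyclic hε0 hnil hnil' hsurj
  have hdet : LinearMap.det g * LinearMap.det g = 1 := by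
    rw [← LinearMap.det_comp, show g ∘ₗ g = LinearMap.id from LinearMap.ext hgg, LinearMap.det_id]
  -- The dimension `k` is odd, so `g` and `-g` have opposite determinants `±1` and one of them has
  -- the required sign.
  obtain ⟨g', hg', hgx', hd⟩ : ∃ g' : E →ₗ[K] E, (∀ u w, B (g' u) (g' w) = B u w) ∧
      (∀ a u, g' (laurentAction x a u) = laurentAction x (invert a) (g' u)) ∧
      LinearMap.det g' = (-1) ^ (finrank K E / 2) := by
    have hneg : LinearMap.det (-g) = -LinearMap.det g := by
      rw [← neg_one_smul K g, LinearMap.det_smul, hn, hk.neg_one_pow, neg_one_mul]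
    have h2 : LinearMap.det g = (-1) ^ (finrank K E / 2) ∨
        LinearMap.det (-g) = (-1) ^ (finrank K E / 2) := by
      rw [hneg]
      rcases mul_self_eq_one_iff.1 hdet with h | h <;>
        rcases neg_one_pow_eq_or K (finrank K E / 2) with h' | h' <;> simp [h, h']
    rcases h2 with h | h
    · exact ⟨g, hg, hgx, h⟩
    · exact ⟨-g, fun u w => by simp [hg], fun a u => by simp [hgx], h⟩
  exact ⟨g', hg', apply_inverter hgx', hd⟩

/-- A vector pairing skew-symmetrically, with respect to `T ↦ T⁻¹`, with a given orbit. -/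
theorem exists_skew_pairing [NeZero (2 : K)] [FiniteDimensional K E] (hB : B.IsSymm)
    (hnd : ∀ u, (∀ v, B u v = 0) → u = 0) (hx : ∀ u v, B (x u) (x v) = B u v) {v : E}
    (hfree : ∀ a, laurentAction x a v = 0 → laurentAction x a = 0) {s : K[T;T⁻¹]}
    (hs : ∀ u, laurentAction x (invert s) u = -laurentAction x s u)
    (hsv : laurentAction x s v ≠ 0) :
    ∃ w, (∀ a, B (laurentAction x (invert a) v) w = -B (laurentAction x a v) w) ∧
      B (laurentAction x s v) w ≠ 0 := by
  have hN : B.Nondegenerate :=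
    ⟨hnd, fun u hu => hnd u fun v => by rw [hB.eq]; exact hu v⟩
  obtain ⟨w₀, hw₀⟩ : ∃ w, B (laurentAction x s v) w ≠ 0 := by
    by_contra! h
    exact hsv (hnd _ h)
  -- Antisymmetrise the pairing with `w₀`. The result kills the annihilator of `v`, so it comes from
  -- a functional on `E`, represented by `w`. At `s`, which is skew, its value is twice the original
  -- pairing.
  let q : K[T;T⁻¹] →ₗ[K] K :=
    (B.flip w₀) ∘ₗ (orbitMap x v - orbitMap x v ∘ₗ (invert (R := K)).toLinearMap)
  have hq (a) : q a = B (laurentAction x a v) w₀ - B (laurentAction x (invert a) v) w₀ := by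
    rw [← LinearMap.sub_apply, ← map_sub]; rfl
  obtain ⟨θ, hθ⟩ : ∃ θ : Dual K E, ∀ a, θ (orbitMap x v a) = q a := by
    have : q ∈ LinearMap.range (orbitMap x v).dualMap := by
      rw [LinearMap.range_dualMap_eq_dualAnnihilator_ker, Submodule.mem_dualAnnihilator]
      intro a ha
      have h := hfree a ha
      rw [hq, h, laurentAction_invert_eq_zero hB hnd hx h]
      simp
    obtain ⟨θ, hθ⟩ := this
    exact ⟨θ, LinearMap.congr_fun hθ⟩
  obtain ⟨w, hw⟩ := (B.toDual hN).surjective θ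
  have hw' (a) : B (laurentAction x a v) w = q a := by
    rw [hB.eq, ← hθ, ← hw]; rfl
  refine ⟨w, fun a => ?_, ?_⟩
  · rw [hw', hw', hq, hq, involutive_invert, neg_sub]
  · rw [hw', hq, hs, map_neg, LinearMap.neg_apply, sub_neg_eq_add, ← two_mul]
    exact mul_ne_zero (NeZero.ne 2) hw₀

/-- Here the socle is skew, so `B (s u) u` always vanishes and no single vector suffices. A pair
`v`, `w` with `B (s v) w ≠ 0` generates `E` freely over the algebra of `x`; the skew pairing of the
two orbits makes `(a, b) ↦ (a*, -b*)` an isometry. -/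
theorem hasInverter_of_even [NeZero (2 : K)] [FiniteDimensional K E] (hB : B.IsSymm)
    (hnd : ∀ u, (∀ v, B u v = 0) → u = 0) (hx : ∀ u v, B (x u) (x v) = B u v)
    (hind : OrthogonallyIndecomposable B (x : E →ₗ[K] E)) (hε : ε * ε = 1) {k : ℕ} (hk0 : 0 < k)
    (hk : Even k) (hnil : laurentAction x (T 1 - C ε) ^ k = 0)
    (hnil' : laurentAction x (T 1 - C ε) ^ (k - 1) ≠ 0) : HasInverter B (x : E →ₗ[K] E) := by
  have hε0 : ε ≠ 0 := by rintro rfl; simp at hε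
  have hodd : Odd (k - 1) := Nat.Even.sub_odd hk0 hk odd_one
  have hinv (u) := laurentAction_invert_socle hε hk0 hnil u
  simp only [hodd.neg_one_pow, neg_one_smul] at hinv
  have hpow := hnil'
  rw [← map_pow] at hnil'
  set s : K[T;T⁻¹] := (T 1 - C ε) ^ (k - 1) with hs
  have hss (u) : B (laurentAction x s u) u = 0 := by
    have h := laurentAction_adjoint B x hx s u u
    rw [hinv, map_neg, hB.eq u, eq_neg_iff_add_eq_zero, ← two_mul] at h
    exact (mul_eq_zero.1 h).resolve_left (NeZero.ne 2)
  obtain ⟨v, hv⟩ : ∃ v, laurentAction x s v ≠ 0 := by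
    by_contra! h
    exact hnil' (LinearMap.ext h)
  obtain ⟨w, hskew, hw⟩ := exists_skew_pairing hB hnd hx (fun a ha => by
    by_contra hne
    obtain ⟨b, hb⟩ := exists_laurentAction_mul_eq_socle hε0 hnil hne
    apply hv
    rw [hs, ← hb, laurentAction_mul, ha, map_zero]) hinv hv
  have hw' : B (laurentAction x s w) v ≠ 0 := by
    rw [laurentAction_adjoint B x hx, hinv, map_neg, hB.eq]
    exact neg_ne_zero.2 hw
  let p : K[T;T⁻¹] × K[T;T⁻¹] →ₗ[K] E := (orbitMap x v).coprod (orbitMap x w)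
  have hp (a b) : p (a, b) = laurentAction x a v + laurentAction x b w := rfl
  have hfree (a b) (h : ∀ f, B (p (a, b)) (p f) = 0) :
      laurentAction x a = 0 ∧ laurentAction x b = 0 := by
    have hv0 (c) : B (laurentAction x c (p (a, b))) v = 0 := by
      rw [laurentAction_adjoint B x hx]
      have := h (invert c, 0)
      rwa [hp (invert c), map_zero, LinearMap.zero_apply, add_zero] at this
    have hw0 (c) : B (laurentAction x c (p (a, b))) w = 0 := by
      rw [laurentAction_adjoint B x hx]
      have := h (0, invert c)
      rwa [hp 0, map_zero, LinearMap.zero_apply, zero_add] at this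
    have hsocle (m : ℕ) (c : K[T;T⁻¹]) (hc : laurentAction x ((T 1 - C ε) ^ (m + 1) * c) = 0) :
        ∃ α : K, laurentAction x ((T 1 - C ε) ^ m * c) = α • laurentAction x s := by
      obtain ⟨q, hq⟩ := laurentAction_eq_aeval hε0 hnil ((T 1 - C ε) ^ m * c)
      obtain ⟨α, hα⟩ := exists_eq_smul_pow _ hnil hpow q (by
        rw [← hq, ← map_mul, ← mul_assoc, ← pow_succ', hc])
      exact ⟨α, by rw [hq, hα, hs, map_pow]⟩
    -- Descent on `m`: once killed by one more factor, both elements are multiples `α s`, `β s` of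
    -- the socle; pairing with `v` isolates `β`, with `w` isolates `α`.
    have key (m : ℕ) : laurentAction x ((T 1 - C ε) ^ m * a) = 0 →
        laurentAction x ((T 1 - C ε) ^ m * b) = 0 →
        laurentAction x a = 0 ∧ laurentAction x b = 0 := by
      induction m with
      | zero => simp only [pow_zero, one_mul]; exact And.intro
      | succ m ih =>
        intro ha hb
        obtain ⟨α, hα⟩ := hsocle m a ha
        obtain ⟨β, hβ⟩ := hsocle m b hb
        have hsum : laurentAction x ((T 1 - C ε) ^ m) (p (a, b)) =
            α • laurentAction x s v + β • laurentAction x s w := by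
          rw [hp, map_add, ← laurentAction_mul, ← laurentAction_mul, hα, hβ]
          rfl
        have h1 := hv0 ((T 1 - C ε) ^ m)
        have h2 := hw0 ((T 1 - C ε) ^ m)
        rw [hsum] at h1 h2
        simp only [map_add, map_smul, LinearMap.add_apply, LinearMap.smul_apply, smul_eq_mul, hss,
          mul_zero, zero_add, add_zero, mul_eq_zero, hw, hw', or_false] at h1 h2
        rw [h1, zero_smul] at hβ
        rw [h2, zero_smul] at hα
        exact ih hα hβ
    refine key k ?_ ?_ <;> rw [map_mul, map_pow, hnil, zero_mul]
  have hzero (a b) (h : p (a, b) = 0) : laurentAction x a = 0 ∧ laurentAction x b = 0 :=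
    hfree a b fun f => by rw [h, map_zero, LinearMap.zero_apply]
  have hsurj : Function.Surjective p := by
    refine eq_top_of_stable (B := B) hind p (fun h => hv ?_) ?_ ?_
    · have := LinearMap.congr_fun h (s, 0)
      rwa [hp, map_zero, LinearMap.zero_apply, add_zero] at this
    · rintro ⟨a, b⟩
      refine ⟨(T 1 * a, T 1 * b), ?_⟩
      rw [hp, hp, laurentAction_mul, laurentAction_mul, laurentAction_T_one, laurentAction_T_one,
        map_add]
    · rintro ⟨a, b⟩ h
      obtain ⟨h1, h2⟩ := hfree a b h
      rw [hp, h1, h2, LinearMap.zero_apply, LinearMap.zero_apply, add_zero]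
  have hex (u : E) : ∃ a b, p (a, b) = u := by
    obtain ⟨⟨a, b⟩, h⟩ := hsurj u
    exact ⟨a, b, h⟩
  obtain ⟨g, hg⟩ := exists_descend p hsurj
    ((invert (R := K)).toLinearMap.prodMap (-(invert (R := K)).toLinearMap)) (by
      rintro ⟨a, b⟩ h
      obtain ⟨h1, h2⟩ := hzero a b h
      change p (invert a, -invert b) = 0
      rw [hp, map_neg, laurentAction_invert_eq_zero hB hnd hx h1,
        laurentAction_invert_eq_zero hB hnd hx h2]
      simp)
  replace hg (a b) : g (p (a, b)) = p (invert a, -invert b) := hg (a, b)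
  -- Exchanging the generators anticommutes with `g`, which treats them with opposite signs.
  obtain ⟨J, hJ⟩ := exists_descend p hsurj (LinearEquiv.prodComm K K[T;T⁻¹] K[T;T⁻¹]).toLinearMap
    (by
      rintro ⟨a, b⟩ h
      obtain ⟨h1, h2⟩ := hzero a b h
      change p (b, a) = 0
      rw [hp, h1, h2]
      simp)
  replace hJ (a b) : J (p (a, b)) = p (b, a) := hJ (a, b)
  have hskew' (a b) : B (laurentAction x (invert a) v) (laurentAction x (invert b) w) =
      -B (laurentAction x a v) (laurentAction x b w) := by
    rw [← laurentAction_adjoint B x hx, ← laurentAction_mul,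
      ← involutive_invert (b * invert a), hskew, map_mul, involutive_invert,
      mul_comm, laurentAction_mul, laurentAction_comm, laurentAction_adjoint B x hx,
      involutive_invert]
  refine ⟨g, fun u u' => ?_, apply_inverter fun c u => ?_,
    det_involution g (fun u => ?_) J (Function.LeftInverse.injective (g := J) fun u => ?_)
      fun u => ?_⟩
  · obtain ⟨a, b, rfl⟩ := hex u
    obtain ⟨c, d, rfl⟩ := hex u'
    have h1 := laurentAction_invert_invert hx a c v v
    have h2 := laurentAction_invert_invert hx b d w w
    rw [hB.eq (laurentAction x c v)] at h1
    rw [hB.eq (laurentAction x d w)] at h2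
    rw [hg, hg]
    simp only [hp, map_neg, map_add, LinearMap.add_apply, LinearMap.neg_apply]
    rw [hB.eq (laurentAction x (invert b) w) (laurentAction x (invert c) v),
      hB.eq (laurentAction x b w) (laurentAction x c v), h1, h2, hskew', hskew']
    ring
  · obtain ⟨a, b, rfl⟩ := hex u
    have h (c a b) : laurentAction x c (p (a, b)) = p (c * a, c * b) := by
      rw [hp, hp, map_add, laurentAction_mul, laurentAction_mul]
    rw [h, hg, hg, h, map_mul, map_mul, mul_neg]
  · obtain ⟨a, b, rfl⟩ := hex u
    rw [hg, hg, map_neg, neg_neg, involutive_invert, involutive_invert]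
  · obtain ⟨a, b, rfl⟩ := hex u
    rw [hJ, hJ]
  · obtain ⟨a, b, rfl⟩ := hex u
    rw [hJ, hg, hg, hJ, ← map_neg p, Prod.neg_mk, neg_neg]

/-- The identity `(T - ε)² = T (T + T⁻¹ - 2ε)` makes `x - ε` nilpotent as well. -/
theorem hasInverter_of_isNilpotent [NeZero (2 : K)] [FiniteDimensional K E] [Nontrivial E]
    (hB : B.IsSymm) (hnd : ∀ u, (∀ v, B u v = 0) → u = 0) (hx : ∀ u v, B (x u) (x v) = B u v)
    (hind : OrthogonallyIndecomposable B (x : E →ₗ[K] E)) (hε : ε * ε = 1)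
    (hnil : IsNilpotent (laurentAction x (T 1 + T (-1) - C (2 * ε)))) :
    HasInverter B (x : E →ₗ[K] E) := by
  have hN : IsNilpotent (laurentAction x (T 1 - C ε)) := by
    have h : (T 1 - C ε : K[T;T⁻¹]) ^ 2 = T 1 * (T 1 + T (-1) - C (2 * ε)) := by
      have h1 : (C ε * C ε : K[T;T⁻¹]) = 1 := by rw [← map_mul, hε, map_one]
      have h2 : (T 1 * T (-1) : K[T;T⁻¹]) = 1 := by rw [← T_add, add_neg_cancel, T_zero]
      rw [map_mul, map_ofNat]
      linear_combination h1 - h2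
    rw [← IsNilpotent.pow_iff_pos two_ne_zero, ← map_pow, h, map_mul]
    refine Commute.isNilpotent_mul_left ?_ hnil
    rw [Commute, SemiconjBy, ← map_mul, ← map_mul, mul_comm]
  have h1 := pow_nilpotencyClass hN
  have h2 := pow_pred_nilpotencyClass hN
  rcases Nat.even_or_odd (nilpotencyClass (laurentAction x (T 1 - C ε))) with hk | hk
  · exact hasInverter_of_even hB hnd hx hind hε (pos_nilpotencyClass_iff.2 hN) hk h1 h2
  · exact hasInverter_of_odd hB hnd hx hind hε hk h1 h2

end UnipotentInverter

/-! ### Assembly of the cases and the theorem. -/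

variable {K : Type*} [Field K] [NeZero (2 : K)] {E : Type u} [AddCommGroup E] [Module K E]
  [FiniteDimensional K E] {B : LinearMap.BilinForm K E}

theorem OrthogonallyIndecomposable.hasInverter {x : E →ₗ[K] E} (hB : B.IsSymm)
    (hnd : ∀ u, (∀ v, B u v = 0) → u = 0) (hx : ∀ u v, B (x u) (x v) = B u v)
    (hind : OrthogonallyIndecomposable B x) : HasInverter B x := by
  rcases subsingleton_or_nontrivial E with hE | hE
  · refine ⟨LinearMap.id, fun _ _ => rfl, fun _ => Subsingleton.elim _ _, ?_⟩
    rw [LinearMap.det_id, finrank_zero_of_subsingleton, Nat.zero_div, pow_zero]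
  have hinj : Function.Injective x := by
    rw [injective_iff_map_eq_zero]
    intro u hu
    refine hnd u fun v => ?_
    rw [← hx, hu, map_zero, LinearMap.zero_apply]
  obtain ⟨x, rfl⟩ : ∃ e : E ≃ₗ[K] E, (e : E →ₗ[K] E) = x :=
    ⟨LinearEquiv.ofInjectiveEndo x hinj, LinearMap.ext fun _ => rfl⟩
  have hself (c : K) : invert (T 1 + T (-1) - C c : K[T;T⁻¹]) = T 1 + T (-1) - C c := by
    rw [map_sub, map_add, invert_T, invert_T, invert_C, neg_neg, add_comm (T (-1))]
  rcases hind.laurent_isNilpotent_or_injective hnd hx (hself (2 * 1)) with h1 | h1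
  · exact hasInverter_of_isNilpotent hB hnd hx hind (one_mul 1) h1
  rcases hind.laurent_isNilpotent_or_injective hnd hx (hself (2 * -1)) with h2 | h2
  · exact hasInverter_of_isNilpotent hB hnd hx hind (by ring) h2
  refine hasInverter_of_injective hB hnd hx hind ?_
  -- With both symmetric factors injective, so is the square of `x - x⁻¹`, hence `x - x⁻¹` itself.
  have hprod : (T 1 - T (-1) : K[T;T⁻¹]) * (T 1 - T (-1)) =
      (T 1 + T (-1) - C (2 * 1)) * (T 1 + T (-1) - C (2 * -1)) := by
    have h2 : (T 1 * T (-1) : K[T;T⁻¹]) = 1 := by rw [← T_add, add_neg_cancel, T_zero]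
    simp only [map_mul, map_neg, map_one, map_ofNat]
    linear_combination (-4) * h2
  refine Function.Injective.of_comp (f := laurentAction x (T 1 - T (-1))) ?_
  rw [← Module.End.coe_mul, ← map_mul, hprod, map_mul, Module.End.coe_mul]
  exact h1.comp h2

/-- Every isometry is conjugate to its inverse by an isometry of controlled determinant. -/
theorem hasInverter {x : E →ₗ[K] E} (hB : B.IsSymm) (hnd : B.Nondegenerate)
    (hx : ∀ u v, B (x u) (x v) = B u v) : HasInverter B x :=
  hasInverter_of_indecomposable
    (fun _ _ _ _ _ _ hB hnd hx hind => hind.hasInverter hB hnd hx) E B x hB hnd.1 hx rfl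

end MVW

theorem theorem2p3 {K E : Type*} [Field K] [CharZero K]
    [AddCommGroup E] [Module K E] [FiniteDimensional K E]
    (B : LinearMap.BilinForm K E) (hsymm : B.IsSymm) (hnondeg : B.Nondegenerate)
    (x : MVW.specialOrthogonalGroup B) :
    ∃ g : MVW.extendedSpecialOrthogonalGroup B,
      g ∉ (MVW.specialOrthogonalInclusion B).range ∧
      g * MVW.specialOrthogonalInclusion B x * g⁻¹ = (MVW.specialOrthogonalInclusion B x)⁻¹ := by
  obtain ⟨g, hg, hgx, hd⟩ : ∃ g : E →ₗ[K] E, (∀ u v, B (g u) (g v) = B u v) ∧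
      (∀ u, x.1.1 (g (x.1.1 u)) = g u) ∧
      LinearMap.det g = (-1) ^ ((Module.finrank K E + 1) / 2) := by
    obtain ⟨g, hg, hgx, hd⟩ := MVW.hasInverter (x := (x.1.1 : E →ₗ[K] E)) hsymm hnondeg x.1.2
    -- The exponents `⌊n / 2⌋` and `⌊(n + 1) / 2⌋` differ only for odd `n`, exactly when `-g` has
    -- the opposite determinant.
    rcases Nat.even_or_odd' (Module.finrank K E) with ⟨m, hm | hm⟩
    · refine ⟨g, hg, hgx, ?_⟩
      rw [hd, hm]
      congr 1
      omega
    · refine ⟨-g, fun u v => by simp [hg], fun u => ?_, ?_⟩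
      · simpa using hgx u
      · rw [← neg_one_smul K g, LinearMap.det_smul, hd, ← pow_add, hm,
          show 2 * m + 1 + (2 * m + 1) / 2 = 2 * m + (2 * m + 1 + 1) / 2 by omega, pow_add,
          pow_mul]
        simp
  have hinj : Function.Injective g := by
    rw [injective_iff_map_eq_zero]
    intro u hu
    refine hnondeg.1 u fun v => ?_
    rw [← hg, hu, map_zero, LinearMap.zero_apply]
  let e : E ≃ₗ[K] E := LinearEquiv.ofInjectiveEndo g hinj
  let γ : MVW.orthogonalGroup B := ⟨e, hg⟩
  have hγ : MVW.orthogonalDet B γ =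
      MVW.signHom K (-1) ^ ((Module.finrank K E + 1) / 2) := by
    apply Units.ext
    have : (MVW.signHom K (-1) : K) = -1 := by simp [MVW.signHom]
    rw [Units.val_pow_eq_pow_val, this, ← hd]
    exact LinearEquiv.coe_det e
  -- The sign `-1` keeps the pair outside `SO(E)`, all of whose elements have sign `1`.
  refine ⟨⟨(γ, -1), hγ⟩, ?_, ?_⟩
  · rintro ⟨y, hy⟩
    have h : (1 : ℤˣ) = -1 := congrArg (fun z => z.1.2) hy
    exact absurd h (by decide)
  · rw [mul_inv_eq_iff_eq_mul, eq_inv_mul_iff_mul_eq]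
    apply Subtype.ext
    apply Prod.ext
    · apply Subtype.ext
      ext u
      exact hgx u
    · simp [MVW.specialOrthogonalInclusion]
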